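/- Let $m\ge 1$ and $n=2m$. A lattice path in the $\frac n2\times\frac n2$ box is a string of $n$ moves, each "up" or "down", with exactly $n/2$ up moves and $n/2$ down moves. Consider the Markov chain on these paths which at each step picks one of the $n-1$ internal columns (that is, one of the $n-1$ pairs of adjacent moves) uniformly at random and, independently and with probability $\frac12$ each, tries either to push the path up at that column (a down move followed by an up move is replaced by an up move followed by a down move) or to push it down there (an up move followed by a down move is replaced by a down move followed by an up move); if the push is impossible the path is left unchanged. The choices made at different steps are independent. Run two copies of this chain with the same random choices of columns and directions, one started at time $0$ from the top path (all up moves first) and the other from the bottom path (all down moves first), and let $\tau_n$ be the first time at which the two paths are equal ($\tau_n=\infty$ if this never happens). Then there is a sequence $\delta_n\to 0$ such that, as $n\to\infty$ through the even integers, $$\Pr\left[\tau_n\ \ge\ (1-\delta_n)\,\frac{2}{\pi^2}\,n^3\log n\right]\ \longrightarrow\ 1 .$$ -/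

import Mathlib

open Filter Topology MeasureTheory

/-- Lattice paths from the leftmost to the rightmost corner of the (rotated) `a × b` box, encoded
as strings of `a + b` moves, `true` being an up move and `false` a down move, with exactly `b` up
moves (and therefore exactly `a` down moves). -/
def LatticePath (a b : ℕ) : Type :=
  {w : Fin (a + b) → Bool // (Finset.univ.filter fun i => w i = true).card = b}

namespace LatticePath

variable {a b : ℕ}

/-- The topmost path: all `b` up moves come first. -/
def top (a b : ℕ) : LatticePath a b :=
  ⟨fun i => decide (i.val < b), by
    have h : (Finset.univ.filter fun i : Fin (a + b) => decide (i.val < b) = true)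
        = (Finset.univ : Finset (Fin b)).map (Fin.castLEEmb (Nat.le_add_left b a)) := by
      ext i
      simp only [decide_eq_true_eq, Finset.mem_filter, Finset.mem_univ, true_and, Finset.mem_map]
      constructor
      · intro hi
        exact ⟨⟨i.val, hi⟩, rfl⟩
      · rintro ⟨j, rfl⟩
        exact j.isLt
    rw [h]; simp⟩

/-- The bottommost path: all `a` down moves come first. -/
def bottom (a b : ℕ) : LatticePath a b :=
  ⟨fun i => decide (a ≤ i.val), by
    have h : (Finset.univ.filter fun i : Fin (a + b) => decide (a ≤ i.val) = true)
        = (Finset.univ : Finset (Fin b)).map (Fin.natAddEmb a) := by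
      ext i
      simp only [decide_eq_true_eq, Finset.mem_filter, Finset.mem_univ, true_and, Finset.mem_map]
      constructor
      · intro hi
        exact ⟨⟨i.val - a, by omega⟩, by ext; simp; omega⟩
      · rintro ⟨j, rfl⟩
        simp
    rw [h]; simp⟩

/-- The letter of the string just to the left of the `x`-th internal column. -/
def leftMove (x : Fin (a + b - 1)) : Fin (a + b) := ⟨x.val, by omega⟩

/-- The letter of the string just to the right of the `x`-th internal column. -/
def rightMove (x : Fin (a + b - 1)) : Fin (a + b) := ⟨x.val + 1, by omega⟩

/-- Exchange the two moves on either side of the internal column `x`. -/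
def exchange (x : Fin (a + b - 1)) (w : LatticePath a b) : LatticePath a b :=
  ⟨fun i => w.1 (Equiv.swap (leftMove x) (rightMove x) i), by
    refine Eq.trans (Finset.card_equiv (Equiv.swap (leftMove x) (rightMove x)) ?_) w.2
    intro i
    simp⟩

/-- Push the path up at the internal column `x`: a valley (down move, then up move) becomes a peak;
otherwise the path is left unchanged. -/
def pushUp (x : Fin (a + b - 1)) (w : LatticePath a b) : LatticePath a b :=
  if w.1 (leftMove x) = false ∧ w.1 (rightMove x) = true then exchange x w else w

/-- Push the path down at the internal column `x`: a peak (up move, then down move) becomes a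
valley; otherwise the path is left unchanged. -/
def pushDown (x : Fin (a + b - 1)) (w : LatticePath a b) : LatticePath a b :=
  if w.1 (leftMove x) = true ∧ w.1 (rightMove x) = false then exchange x w else w

/-- A proposed update: one of the `a + b - 1` internal columns, together with a direction
(`true`: push up, `false`: push down). -/
abbrev Update (a b : ℕ) : Type := Fin (a + b - 1) × Bool

/-- The result of applying an update to a path. -/
def step (u : Update a b) (w : LatticePath a b) : LatticePath a b :=
  if u.2 = true then pushUp u.1 w else pushDown u.1 w

/-- The path at time `t` when started from `w` and driven by the updates `ω 0, ω 1, ω 2, …`.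
Paths driven by the same `ω` are coupled by the monotone grand coupling. -/
def run (ω : ℕ → Update a b) (w : LatticePath a b) : ℕ → LatticePath a b
  | 0 => w
  | t + 1 => step (ω t) (run ω w t)

/-- The first time at which the paths started from the topmost and the bottommost path and driven
by the same updates agree (`⊤` if this never happens). -/
noncomputable def coalescenceTime (ω : ℕ → Update a b) : ℕ∞ :=
  ⨅ (t : ℕ) (_ : run ω (top a b) t = run ω (bottom a b) t), (t : ℕ∞)

instance instNonemptyUpdate [NeZero a] [NeZero b] : Nonempty (Update a b) := by
  have ha : a ≠ 0 := NeZero.ne a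
  have hb : b ≠ 0 := NeZero.ne b
  exact ⟨(⟨0, by omega⟩, true)⟩

/-- The law of an infinite sequence of independent, uniformly distributed updates. -/
noncomputable def updateLaw (a b : ℕ) [NeZero a] [NeZero b] : Measure (ℕ → Update a b) :=
  Measure.infinitePi fun _ : ℕ => (PMF.uniformOfFintype (Update a b)).toMeasure

end LatticePath

/-! Write `n = 2m`. The difference of `weight (cosine n)` between the two extremal paths, called
`gap`, is an eigenfunction of the coupled pair: one step multiplies its conditional mean by `1 - γ`,
where `γ = rate m ≈ π²/(2n³)` (`mean_gap`). It starts at order `n` and vanishes once the paths meet,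
so by Chebyshev (`coalesced_mul_sq_le`) the probability of having met is at most its variance over
its squared mean.

A variance bound of order `n`, uniform in time, would give only half of the stated time. The
variance must be shown to decay along with the mean, as `(1 - γ)^t n (1 + γt)`; the ratio is then
about `e^{γt}(1 + γt)/n`, which tends to zero when `γt = log n - √(log n)`.

The noise in one step is controlled by the number of positions where the paths differ
(`sum_sq_weight_cosine_step_le`). To bound that number, interpolate between bottom and top by paths
in which neighbours differ by one exchange. This relation survives the coupling
(`Differ.step_close`), and each neighbouring pair carries two discrepancies until it merges. A
concave function of their separation drops on average by a definite amount per step while they are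
apart. In `Close.sum_energy_le` this drop pays for the discrepancies and for decay at rate `γ`, up
to a multiple of `γ` times the pair's share of the gap. Adding these energies to `gap ^ 2` cancels
the noise (`average_potential_step_le`), and iterating gives `variance_bound`. -/

namespace LatticePath

/-! ### Linear statistics of a path and their one-step drift -/

section Weight

variable {a b : ℕ}

/-- The indicator that the `i`-th move of `w` is an up move. -/
noncomputable def up (w : LatticePath a b) (i : Fin (a + b)) : ℝ := if w.1 i = true then 1 else 0

/-- The sum of `c i` over the positions `i` of the up moves of `w`. -/
noncomputable def weight (c : ℕ → ℝ) (w : LatticePath a b) : ℝ :=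
  ∑ i : Fin (a + b), c i * up w i

lemma leftMove_ne_rightMove (x : Fin (a + b - 1)) : leftMove x ≠ rightMove x := by
  simp [leftMove, rightMove, Fin.ext_iff]

lemma weight_exchange (c : ℕ → ℝ) (x : Fin (a + b - 1)) (w : LatticePath a b) :
    weight c (exchange x w) - weight c w =
      (c (x + 1) - c x) * (up w (leftMove x) - up w (rightMove x)) := by
  have hne := leftMove_ne_rightMove x
  have h : ∀ i, up (exchange x w) i = up w (Equiv.swap (leftMove x) (rightMove x) i) :=
    fun i => rfl
  unfold weight
  rw [← Finset.sum_sub_distrib, ← Finset.sum_subset (Finset.subset_univ {leftMove x, rightMove x}),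
    Finset.sum_pair hne, h, h, Equiv.swap_apply_left, Equiv.swap_apply_right]
  · simp only [leftMove, rightMove]
    ring
  · intro i _ hi
    simp only [Finset.mem_insert, Finset.mem_singleton, not_or] at hi
    rw [h, Equiv.swap_apply_of_ne_of_ne hi.1 hi.2, sub_self]

lemma weight_step_true (c : ℕ → ℝ) (x : Fin (a + b - 1)) (w : LatticePath a b) :
    weight c (step (x, true) w) - weight c w =
      if w.1 (leftMove x) = false ∧ w.1 (rightMove x) = true then c x - c (x + 1) else 0 := by
  simp only [step, if_true, pushUp]
  split_ifs with h
  · rw [weight_exchange]; simp [up, h.1, h.2]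
  · simp

lemma weight_step_false (c : ℕ → ℝ) (x : Fin (a + b - 1)) (w : LatticePath a b) :
    weight c (step (x, false) w) - weight c w =
      if w.1 (leftMove x) = true ∧ w.1 (rightMove x) = false then c (x + 1) - c x else 0 := by
  have hs : step (x, false) w = pushDown x w := rfl
  rw [hs, pushDown]
  split_ifs with h
  · rw [weight_exchange]; simp [up, h.1, h.2]
  · simp

/-- At each column the two push directions together produce a drift linear in the letters: the
products of occupation variables cancel, as in the symmetric exclusion process. -/
lemma sum_weight_step (c : ℕ → ℝ) (w : LatticePath a b) :
    ∑ u : Update a b, (weight c (step u w) - weight c w) =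
      ∑ x : Fin (a + b - 1), (c (x + 1) - c x) * (up w (leftMove x) - up w (rightMove x)) := by
  rw [Fintype.sum_prod_type]
  refine Finset.sum_congr rfl fun x _ => ?_
  rw [Fintype.sum_bool, weight_step_true, weight_step_false]
  unfold up
  cases w.1 (leftMove x) <;> cases w.1 (rightMove x) <;> simp

/-- The sequence `up w`, extended by zero. -/
noncomputable def upNat (w : LatticePath a b) (i : ℕ) : ℝ :=
  if h : i < a + b then up w ⟨i, h⟩ else 0

lemma sum_weight_step_range (c : ℕ → ℝ) (w : LatticePath a b) :
    ∑ u : Update a b, (weight c (step u w) - weight c w) =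
      ∑ x ∈ Finset.range (a + b - 1), (c (x + 1) - c x) * (upNat w x - upNat w (x + 1)) := by
  rw [sum_weight_step, ← Fin.sum_univ_eq_sum_range
    (fun x => (c (x + 1) - c x) * (upNat w x - upNat w (x + 1)))]
  refine Finset.sum_congr rfl fun x _ => ?_
  have h1 : x.val < a + b := by omega
  have h2 : x.val + 1 < a + b := by omega
  simp [upNat, h1, h2, leftMove, rightMove]

lemma weight_eq_sum_range (c : ℕ → ℝ) (w : LatticePath a b) :
    weight c w = ∑ i ∈ Finset.range (a + b), c i * upNat w i := by
  rw [← Fin.sum_univ_eq_sum_range (fun i => c i * upNat w i)]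
  refine Finset.sum_congr rfl fun x _ => ?_
  simp [upNat]

end Weight

/-! ### The cosine eigenvector of the reflecting walk -/

section Eigenfunction

/-- The first nontrivial eigenvector of the reflecting random walk on `n` sites. -/
noncomputable def cosine (n i : ℕ) : ℝ := Real.cos (Real.pi * (i + 1 / 2) / n)

lemma cosine_recurrence (n i : ℕ) :
    cosine n (i + 2) + cosine n i = 2 * Real.cos (Real.pi / n) * cosine n (i + 1) := by
  have h1 : Real.pi * (((i + 2 : ℕ) : ℝ) + 1 / 2) / n =
      Real.pi * (((i + 1 : ℕ) : ℝ) + 1 / 2) / n + Real.pi / n := by push_cast; ring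
  have h2 : Real.pi * ((i : ℝ) + 1 / 2) / n =
      Real.pi * (((i + 1 : ℕ) : ℝ) + 1 / 2) / n - Real.pi / n := by push_cast; ring
  unfold cosine
  rw [h1, h2, Real.cos_add, Real.cos_sub]
  ring

lemma cosine_one (n : ℕ) :
    cosine n 1 + cosine n 0 = 2 * Real.cos (Real.pi / n) * cosine n 0 := by
  have h1 : Real.pi * (((1 : ℕ) : ℝ) + 1 / 2) / n =
      Real.pi * (((0 : ℕ) : ℝ) + 1 / 2) / n + Real.pi / n := by push_cast; ring
  have h2 : Real.cos (Real.pi * (((0 : ℕ) : ℝ) + 1 / 2) / n) =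
      Real.cos (Real.pi * (((0 : ℕ) : ℝ) + 1 / 2) / n - Real.pi / n) := by
    rw [← Real.cos_neg]; congr 1; push_cast; ring
  rw [Real.cos_sub] at h2
  unfold cosine
  rw [h1, Real.cos_add]
  linear_combination h2

lemma cosine_self {n : ℕ} (hn : 0 < n) : cosine n n = cosine n (n - 1) := by
  have hn' : (n : ℝ) ≠ 0 := by positivity
  have h1 : Real.pi * ((n : ℝ) + 1 / 2) / n = Real.pi / (2 * n) + Real.pi := by
    field_simp; ring
  have h2 : Real.pi * (((n - 1 : ℕ) : ℝ) + 1 / 2) / n = Real.pi - Real.pi / (2 * n) := by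
    rw [Nat.cast_sub hn]; push_cast; field_simp; ring
  unfold cosine
  rw [h1, h2, Real.cos_add_pi, Real.cos_pi_sub]

/-- Summation by parts: the reflection `cosine_one` absorbs the left boundary term, and the right
one is left over until `cosine_self` removes it. -/
lemma sum_cosine_by_parts (n : ℕ) (v : ℕ → ℝ) (N : ℕ) :
    ∑ x ∈ Finset.range (N + 1), (cosine n (x + 1) - cosine n x) * (v x - v (x + 1)) =
      -(2 * (1 - Real.cos (Real.pi / n))) * ∑ i ∈ Finset.range (N + 1), cosine n i * v i
        - v (N + 1) * (cosine n (N + 1) - cosine n N) := by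
  induction N with
  | zero =>
    have := cosine_one n
    simp only [zero_add, Finset.sum_range_one]
    linear_combination v 0 * this
  | succ N ih =>
    rw [Finset.sum_range_succ, ih, Finset.sum_range_succ _ (N + 1)]
    have := cosine_recurrence n N
    linear_combination v (N + 1) * this

variable {a b : ℕ}

lemma sum_weight_cosine_step (w : LatticePath a b) (hn : 2 ≤ a + b) :
    ∑ u : Update a b, (weight (cosine (a + b)) (step u w) - weight (cosine (a + b)) w) =
      -(2 * (1 - Real.cos (Real.pi / (a + b : ℕ)))) * weight (cosine (a + b)) w := by
  rw [sum_weight_step_range, weight_eq_sum_range]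
  obtain ⟨N, hN⟩ : ∃ N, a + b = N + 2 := ⟨a + b - 2, by omega⟩
  generalize hv : upNat w = v
  rw [hN]
  have h1 := cosine_self (n := N + 2) (by omega)
  have h2 := cosine_recurrence (N + 2) N
  simp only [Nat.add_succ_sub_one] at h1 ⊢
  rw [sum_cosine_by_parts, Finset.sum_range_succ _ (N + 1)]
  linear_combination v (N + 1) * h2 - v (N + 1) * h1

lemma sum_weight_id_step (w : LatticePath a b) :
    ∑ u : Update a b, (weight (fun i => (i : ℝ)) (step u w) - weight (fun i => (i : ℝ)) w) =
      upNat w 0 - upNat w (a + b - 1) := by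
  rw [sum_weight_step_range, ← Finset.sum_range_sub']
  refine Finset.sum_congr rfl fun x _ => ?_
  push_cast
  ring

lemma cosine_sub_nonneg {n i : ℕ} (hi : i + 1 < n) : 0 ≤ cosine n i - cosine n (i + 1) := by
  have hn : (0 : ℝ) < n := by
    have : 0 < n := by omega
    exact_mod_cast this
  have hi' : (i : ℝ) + 1 + 1 ≤ n := by exact_mod_cast hi
  have hpi := Real.pi_pos
  rw [sub_nonneg]
  apply Real.cos_le_cos_of_nonneg_of_le_pi
  · positivity
  · rw [div_le_iff₀ hn]; push_cast; nlinarith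
  · gcongr; linarith

lemma cosine_sub_le (n i : ℕ) : cosine n i - cosine n (i + 1) ≤ Real.pi / n := by
  have h := Real.abs_cos_sub_cos_le (Real.pi * (i + 1 / 2) / n)
    (Real.pi * (((i + 1 : ℕ) : ℝ) + 1 / 2) / n)
  have h2 : Real.pi * ((i : ℝ) + 1 / 2) / n - Real.pi * (((i + 1 : ℕ) : ℝ) + 1 / 2) / n =
    -(Real.pi / n) := by push_cast; ring
  rw [h2, abs_neg, abs_of_nonneg (by positivity : 0 ≤ Real.pi / n)] at h
  exact (le_abs_self _).trans h

/-- The difference is twice the product of the sines of the mean angle and of the half-difference.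
The mean angle is at least as far from `0` and from `π` as the half-difference is from `0`, so both
sines are at least `d / n` by Jordan's inequality. -/
lemma two_mul_sq_le_cosine_sub {n x y : ℕ} (hxy : x < y) (hy : y < n) :
    2 * (((y : ℝ) - x) / n) ^ 2 ≤ cosine n x - cosine n y := by
  have hn : (0 : ℝ) < n := by
    have : 0 < n := by omega
    exact_mod_cast this
  have hxy' : (x : ℝ) + 1 ≤ y := by exact_mod_cast hxy
  have hy' : (y : ℝ) + 1 ≤ n := by exact_mod_cast hy
  have hx0 : (0 : ℝ) ≤ x := by positivity
  have hpi := Real.pi_pos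
  set d : ℝ := (y : ℝ) - x with hd
  have hd0 : 0 ≤ d := by linarith
  have hdn : d ≤ n := by linarith
  have hsin : d / n ≤ Real.sin (Real.pi * d / (2 * n)) := by
    have := Real.mul_le_sin (x := Real.pi * d / (2 * n)) (by positivity)
      (by rw [div_le_div_iff₀ (by positivity) (by positivity)]; nlinarith)
    refine le_trans (le_of_eq ?_) this
    field_simp
  have hsin' : Real.sin (Real.pi * d / (2 * n)) ≤
      Real.sin (Real.pi * (x + y + 1) / (2 * n)) := by
    rcases le_total ((x : ℝ) + y + 1) n with h | h
    · apply Real.sin_le_sin_of_le_of_le_pi_div_two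
      · have : 0 ≤ Real.pi * d / (2 * n) := by positivity
        linarith
      · rw [div_le_div_iff₀ (by positivity) (by positivity)]; nlinarith
      · gcongr; linarith
    · rw [← Real.sin_pi_sub (Real.pi * (x + y + 1) / (2 * n))]
      have e : Real.pi - Real.pi * (x + y + 1) / (2 * n) =
          Real.pi * (2 * n - (x + y + 1)) / (2 * n) := by field_simp
      rw [e]
      apply Real.sin_le_sin_of_le_of_le_pi_div_two
      · have : 0 ≤ Real.pi * d / (2 * n) := by positivity
        linarith
      · rw [div_le_div_iff₀ (by positivity) (by positivity)]; nlinarith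
      · gcongr; linarith
  have hf : cosine n x - cosine n y =
      2 * Real.sin (Real.pi * (x + y + 1) / (2 * n)) * Real.sin (Real.pi * d / (2 * n)) := by
    unfold cosine
    rw [Real.cos_sub_cos]
    have e1 : (Real.pi * ((x : ℝ) + 1 / 2) / n + Real.pi * ((y : ℝ) + 1 / 2) / n) / 2 =
      Real.pi * (x + y + 1) / (2 * n) := by field_simp; ring
    have e2 : (Real.pi * ((x : ℝ) + 1 / 2) / n - Real.pi * ((y : ℝ) + 1 / 2) / n) / 2 =
      -(Real.pi * d / (2 * n)) := by rw [hd]; field_simp; ring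
    rw [e1, e2, Real.sin_neg]
    ring
  have h0 : 0 ≤ d / n := by positivity
  rw [hf]
  nlinarith [mul_le_mul hsin (hsin.trans hsin') h0 (h0.trans hsin)]

end Eigenfunction
-- Pairs of paths differing by one exchange
section Pairs

variable {a b : ℕ}

/-- A push sorts the two letters at the column, so it acts by Boolean `or` and `and` whatever they
are. -/
lemma step_apply (e : Fin (a + b - 1)) (s : Bool) (w : LatticePath a b) (i : Fin (a + b)) :
    (step (e, s) w).1 i =
      if i = leftMove e then
        (if s then w.1 (leftMove e) || w.1 (rightMove e) else w.1 (leftMove e) && w.1 (rightMove e))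
      else if i = rightMove e then
        (if s then w.1 (leftMove e) && w.1 (rightMove e) else w.1 (leftMove e) || w.1 (rightMove e))
      else w.1 i := by
  have hne := leftMove_ne_rightMove e
  have hx : (exchange e w).1 i = w.1 (Equiv.swap (leftMove e) (rightMove e) i) := rfl
  cases s
  · have hs : step (e, false) w = pushDown e w := rfl
    rw [hs, pushDown]
    split_ifs with h h1 h2 h1 h2 <;> simp_all [Equiv.swap_apply_def]
  · have hs : step (e, true) w = pushUp e w := rfl
    rw [hs, pushUp]
    split_ifs with h h1 h2 h1 h2 <;> simp_all [Equiv.swap_apply_def] <;> grind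

/-- `w'` arises from `w` by exchanging a down move at `x` with a later up move at `y`. -/
structure Differ (w w' : LatticePath a b) (x y : Fin (a + b)) : Prop where
  lt : x < y
  left : w.1 x = false
  left' : w'.1 x = true
  right : w.1 y = true
  right' : w'.1 y = false
  off : ∀ i, i ≠ x → i ≠ y → w.1 i = w'.1 i

/-- The paths `w` and `w'` are equal or arise from each other by one exchange, `w'` being above. -/
def Close (w w' : LatticePath a b) : Prop := w = w' ∨ ∃ x y, Differ w w' x y

-- A discrepancy moves only if the chosen column touches it. If the column touches both they
-- annihilate; if it touches one, that one ends at the left or right letter of the column and cannot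
-- pass the other.
set_option maxHeartbeats 2000000 in
lemma Differ.step_close {w w' : LatticePath a b} {x y : Fin (a + b)} (h : Differ w w' x y)
    (u : Update a b) : Close (step u w) (step u w') := by
  obtain ⟨e, s⟩ := u
  obtain ⟨hlt, hl, hl', hr, hr', hoff⟩ := h
  have hv : (leftMove e).val + 1 = (rightMove e).val := rfl
  have hw := step_apply e s w
  have hw' := step_apply e s w'
  set l := leftMove e
  set r := rightMove e
  have hne : l ≠ r := by intro h; simp [h] at hv
  by_cases hxl : x = l
  · subst hxl
    by_cases hyr : y = r
    · subst hyr
      left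
      apply Subtype.ext
      funext i
      rw [hw, hw', hl, hl', hr, hr']
      have := hoff i
      split_ifs <;> simp_all
    · have hoffr := hoff r hne.symm (Ne.symm hyr)
      have hyx : y ≠ l := by rintro rfl; exact lt_irrefl _ hlt
      right
      have hry : r < y := by
        rw [Fin.lt_def] at hlt ⊢
        have : y.val ≠ r.val := fun h => hyr (Fin.ext h)
        omega
      -- The other letter at the column is common to both paths. The discrepancy ends on the right
      -- exactly when that letter equals the push direction.
      by_cases hc : w.1 r = s
      · refine ⟨r, y, hry, ?_, ?_, ?_, ?_, ?_⟩
        · rw [hw]; simp [hne.symm, hl]; cases s <;> simp_all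
        · rw [hw']; simp [hne.symm, hl']; cases s <;> simp_all
        · rw [hw]; simp [hyx, hyr, hr]
        · rw [hw']; simp [hyx, hyr, hr']
        · intro i h1 h2
          rw [hw, hw', hl, hl', ← hoffr, hc]
          have := hoff i
          cases s <;> split_ifs <;> simp_all
      · refine ⟨l, y, hlt, ?_, ?_, ?_, ?_, ?_⟩
        · rw [hw]; simp [hl]; cases s <;> simp_all
        · rw [hw']; simp [hl']; cases s <;> simp_all
        · rw [hw]; simp [hyx, hyr, hr]
        · rw [hw']; simp [hyx, hyr, hr']
        · intro i h1 h2
          rw [hw, hw', hl, hl', ← hoffr]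
          have := hoff i
          cases s <;> split_ifs <;> simp_all
  · by_cases hxr : x = r
    · subst hxr
      have hoffl := hoff l hne (by rintro rfl; rw [Fin.lt_def] at hlt; omega)
      have hyl : y ≠ l := by rintro rfl; rw [Fin.lt_def] at hlt; omega
      have hyr : y ≠ r := hlt.ne'
      have hly : l < y := by rw [Fin.lt_def] at hlt ⊢; omega
      right
      by_cases hc : w.1 l = s
      · refine ⟨r, y, hlt, ?_, ?_, ?_, ?_, ?_⟩
        · rw [hw]; simp [hne.symm, hl]; cases s <;> simp_all
        · rw [hw']; simp [hne.symm, hl']; cases s <;> simp_all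
        · rw [hw]; simp [hyl, hyr, hr]
        · rw [hw']; simp [hyl, hyr, hr']
        · intro i h1 h2
          rw [hw, hw', hl, hl', ← hoffl, hc]
          have := hoff i
          cases s <;> split_ifs <;> simp_all
      · refine ⟨l, y, hly, ?_, ?_, ?_, ?_, ?_⟩
        · rw [hw]; simp [hl]; cases s <;> simp_all
        · rw [hw']; simp [hl']; cases s <;> simp_all
        · rw [hw]; simp [hyl, hyr, hr]
        · rw [hw']; simp [hyl, hyr, hr']
        · intro i h1 h2
          rw [hw, hw', hl, hl', ← hoffl]
          have := hoff i
          cases s <;> split_ifs <;> simp_all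
    · right
      by_cases hyl : y = l
      · subst hyl
        have hoffr := hoff r (Ne.symm hxr) hne.symm
        have hxr' : x < r := by rw [Fin.lt_def] at hlt ⊢; omega
        by_cases hc : w.1 r = s
        · refine ⟨x, r, hxr', ?_, ?_, ?_, ?_, ?_⟩
          · rw [hw]; simp [hxl, hxr, hl]
          · rw [hw']; simp [hxl, hxr, hl']
          · rw [hw]; simp [hne.symm, hr]; cases s <;> simp_all
          · rw [hw']; simp [hne.symm, hr']; cases s <;> simp_all
          · intro i h1 h2
            rw [hw, hw', hr, hr', ← hoffr, hc]
            have := hoff i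
            cases s <;> split_ifs <;> simp_all
        · refine ⟨x, l, hlt, ?_, ?_, ?_, ?_, ?_⟩
          · rw [hw]; simp [hxl, hxr, hl]
          · rw [hw']; simp [hxl, hxr, hl']
          · rw [hw]; simp [hr]; cases s <;> simp_all
          · rw [hw']; simp [hr']; cases s <;> simp_all
          · intro i h1 h2
            rw [hw, hw', hr, hr', ← hoffr]
            have := hoff i
            cases s <;> split_ifs <;> simp_all
      · by_cases hyr : y = r
        · subst hyr
          have hoffl := hoff l (Ne.symm hxl) hne
          have hxl' : x < l := by
            rw [Fin.lt_def] at hlt ⊢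
            have : x.val ≠ l.val := fun h => hxl (Fin.ext h)
            omega
          by_cases hc : w.1 l = s
          · refine ⟨x, r, hlt, ?_, ?_, ?_, ?_, ?_⟩
            · rw [hw]; simp [hxl, hxr, hl]
            · rw [hw']; simp [hxl, hxr, hl']
            · rw [hw]; simp [hne.symm, hr]; cases s <;> simp_all
            · rw [hw']; simp [hne.symm, hr']; cases s <;> simp_all
            · intro i h1 h2
              rw [hw, hw', hr, hr', ← hoffl, hc]
              have := hoff i
              cases s <;> split_ifs <;> simp_all
          · refine ⟨x, l, hxl', ?_, ?_, ?_, ?_, ?_⟩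
            · rw [hw]; simp [hxl, hxr, hl]
            · rw [hw']; simp [hxl, hxr, hl']
            · rw [hw]; simp [hr]; cases s <;> simp_all
            · rw [hw']; simp [hr']; cases s <;> simp_all
            · intro i h1 h2
              rw [hw, hw', hr, hr', ← hoffl]
              have := hoff i
              cases s <;> split_ifs <;> simp_all
        · refine ⟨x, y, hlt, ?_, ?_, ?_, ?_, ?_⟩
          · rw [hw]; simp [hxl, hxr, hl]
          · rw [hw']; simp [hxl, hxr, hl']
          · rw [hw]; simp [hyl, hyr, hr]
          · rw [hw']; simp [hyl, hyr, hr']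
          · intro i h1 h2
            have h1 := hoff l (Ne.symm hxl) (Ne.symm hyl)
            have h2 := hoff r (Ne.symm hxr) (Ne.symm hyr)
            rw [hw, hw', h1, h2]
            have := hoff i
            split_ifs <;> simp_all

lemma Close.step_close {w w' : LatticePath a b} (h : Close w w') (u : Update a b) :
    Close (step u w) (step u w') := by
  rcases h with rfl | ⟨x, y, h⟩
  · exact Or.inl rfl
  · exact h.step_close u

lemma Differ.weight_sub {w w' : LatticePath a b} {x y : Fin (a + b)} (h : Differ w w' x y)
    (c : ℕ → ℝ) : weight c w' - weight c w = c x - c y := by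
  unfold weight
  rw [← Finset.sum_sub_distrib, ← Finset.sum_subset (Finset.subset_univ {x, y}),
    Finset.sum_pair h.lt.ne]
  · simp [up, h.left, h.left', h.right, h.right']
    ring
  · intro i _ hi
    simp only [Finset.mem_insert, Finset.mem_singleton, not_or] at hi
    simp [up, h.off i hi.1 hi.2]

/-- The number of positions at which two paths differ. -/
def discrepancy (w w' : LatticePath a b) : ℕ := hammingDist w.1 w'.1

lemma discrepancy_self (w : LatticePath a b) : discrepancy w w = 0 := hammingDist_self _

lemma Differ.discrepancy_le {w w' : LatticePath a b} {x y : Fin (a + b)} (h : Differ w w' x y) :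
    discrepancy w w' ≤ 2 := by
  unfold discrepancy hammingDist
  refine le_trans (Finset.card_le_card (t := {x, y}) ?_) Finset.card_le_two
  intro i hi
  simp only [Finset.mem_filter, Finset.mem_univ, true_and] at hi
  simp only [Finset.mem_insert, Finset.mem_singleton]
  by_contra hcon
  push Not at hcon
  exact hi (h.off i hcon.1 hcon.2)

/-- The horizontal distance between the two discrepancies of a close pair. -/
noncomputable def separation (w w' : LatticePath a b) : ℝ :=
  weight (fun i => (i : ℝ)) w - weight (fun i => (i : ℝ)) w'

lemma separation_self (w : LatticePath a b) : separation w w = 0 := sub_self _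

lemma Differ.separation_eq {w w' : LatticePath a b} {x y : Fin (a + b)} (h : Differ w w' x y) :
    separation w w' = (y : ℝ) - x := by
  have := h.weight_sub (fun i => (i : ℝ))
  unfold separation
  linarith

/-- The drift of the separation telescopes to the ends of the string, where a discrepancy can only
move inwards. -/
lemma Differ.sum_separation_nonpos {w w' : LatticePath a b} {x y : Fin (a + b)}
    (h : Differ w w' x y) :
    ∑ u : Update a b, (separation (step u w) (step u w') - separation w w') ≤ 0 := by
  have e : ∑ u : Update a b, (separation (step u w) (step u w') - separation w w') =
      (upNat w 0 - upNat w (a + b - 1)) - (upNat w' 0 - upNat w' (a + b - 1)) := by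
    rw [← sum_weight_id_step w, ← sum_weight_id_step w', ← Finset.sum_sub_distrib]
    refine Finset.sum_congr rfl fun u _ => ?_
    unfold separation
    ring
  have hlt := h.lt
  rw [Fin.lt_def] at hlt
  have hy := y.isLt
  have key : ∀ i (hi : i < a + b), i ≠ y.val → upNat w i ≤ upNat w' i := by
    intro i hi hne
    simp only [upNat, hi, dif_pos, up]
    by_cases hx : (⟨i, hi⟩ : Fin (a + b)) = x
    · rw [hx, h.left, h.left']; simp
    · rw [h.off _ hx (fun hh => hne (by rw [← hh]))]
  have key' : ∀ i (hi : i < a + b), i ≠ x.val → upNat w' i ≤ upNat w i := by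
    intro i hi hne
    simp only [upNat, hi, dif_pos, up]
    by_cases hx : (⟨i, hi⟩ : Fin (a + b)) = y
    · rw [hx, h.right, h.right']; simp
    · rw [h.off _ (fun hh => hne (by rw [← hh])) hx]
  have h1 := key 0 (by omega) (by omega)
  have h2 := key' (a + b - 1) (by omega) (by omega)
  rw [e]
  linarith

/-- The column just right of `x` has a direction that moves exactly one of the paths, according to
the letter following `x`. -/
lemma Differ.exists_separation_step {w w' : LatticePath a b} {x y : Fin (a + b)}
    (h : Differ w w' x y) :
    ∃ u : Update a b, separation (step u w) (step u w') - separation w w' = -1 := by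
  have hlt := h.lt
  rw [Fin.lt_def] at hlt
  have hy := y.isLt
  let e : Fin (a + b - 1) := ⟨x.val, by omega⟩
  have hl : leftMove e = x := rfl
  have hr : x ≠ rightMove e := leftMove_ne_rightMove e
  by_cases hc : w.1 (rightMove e) = true
  · refine ⟨(e, true), ?_⟩
    have h1 := weight_step_true (fun i => (i : ℝ)) e w
    have h2 := weight_step_true (fun i => (i : ℝ)) e w'
    rw [hl, if_pos ⟨h.left, hc⟩] at h1
    rw [hl, if_neg (by simp [h.left'])] at h2
    push_cast at h1
    unfold separation
    linarith
  · have hry : rightMove e ≠ y := by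
      intro hh
      rw [hh] at hc
      exact hc h.right
    have hw' := h.off _ hr.symm hry
    refine ⟨(e, false), ?_⟩
    have h1 := weight_step_false (fun i => (i : ℝ)) e w
    have h2 := weight_step_false (fun i => (i : ℝ)) e w'
    rw [hl, if_neg (by simp [h.left])] at h1
    rw [hl, if_pos ⟨h.left', by rw [← hw']; simpa using hc⟩] at h2
    push_cast at h2
    unfold separation
    linarith

/-- A concave function of the separation. -/
noncomputable def energy (w w' : LatticePath a b) : ℝ :=
  separation w w' * (2 * (a + b : ℕ) - separation w w')

lemma energy_self (w : LatticePath a b) : energy w w = 0 := by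
  simp [energy, separation_self]

/-- The second-order term of the quadratic supplies the `-1`, through the update of
`Differ.exists_separation_step`. The first-order term has the right sign because the separation is
at most `n`. -/
lemma Differ.sum_energy_le {w w' : LatticePath a b} {x y : Fin (a + b)} (h : Differ w w' x y) :
    ∑ u : Update a b, (energy (step u w) (step u w') - energy w w') ≤ -1 := by
  obtain ⟨u₀, hu₀⟩ := h.exists_separation_step
  have h0 := h.sum_separation_nonpos
  have hd := h.separation_eq
  set δ : Update a b → ℝ := fun u => separation (step u w) (step u w') - separation w w' with hδ
  have e : ∀ u : Update a b, energy (step u w) (step u w') - energy w w' =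
      2 * ((a + b : ℕ) - separation w w') * δ u - δ u ^ 2 := by
    intro u
    simp only [hδ, energy]
    ring
  rw [Finset.sum_congr rfl fun u _ => e u, Finset.sum_sub_distrib, ← Finset.mul_sum]
  have h1 : (1 : ℝ) ≤ ∑ u, δ u ^ 2 := by
    refine le_trans (le_of_eq ?_)
      (Finset.single_le_sum (f := fun u => δ u ^ 2) (fun u _ => sq_nonneg _) (Finset.mem_univ u₀))
    simp only [hδ, hu₀]
    norm_num
  have hy : (y : ℝ) ≤ (a + b : ℕ) := by exact_mod_cast y.isLt.le
  have hx : (0 : ℝ) ≤ (x : ℕ) := by positivity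
  have h2 : 0 ≤ ((a + b : ℕ) : ℝ) - separation w w' := by rw [hd]; linarith
  have h3 : ∑ u, δ u ≤ 0 := h0
  nlinarith

lemma Differ.sq_le_weight_sub {w w' : LatticePath a b} {x y : Fin (a + b)} (h : Differ w w' x y) :
    2 * (separation w w' / (a + b : ℕ)) ^ 2 ≤
      weight (cosine (a + b)) w' - weight (cosine (a + b)) w := by
  rw [h.weight_sub, h.separation_eq]
  exact two_mul_sq_le_cosine_sub (Fin.lt_def.1 h.lt) y.isLt

lemma Close.energy_nonneg {w w' : LatticePath a b} (h : Close w w') : 0 ≤ energy w w' := by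
  rcases h with rfl | ⟨x, y, h⟩
  · rw [energy_self]
  · have hy : (y : ℝ) ≤ (a + b : ℕ) := by exact_mod_cast y.isLt.le
    have hx : (0 : ℝ) ≤ (x : ℕ) := by positivity
    have hxy : (x : ℝ) ≤ y := by exact_mod_cast (Fin.lt_def.1 h.lt).le
    rw [energy, h.separation_eq]
    apply mul_nonneg <;> linarith

lemma one_sub_cos_pi_div_le {n : ℕ} (hn : 0 < n) :
    (1 - Real.cos (Real.pi / n)) * n ^ 2 ≤ 5 := by
  have h := Real.one_sub_sq_div_two_le_cos (x := Real.pi / n)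
  have hn' : (0 : ℝ) < n := by exact_mod_cast hn
  have h1 : 1 - Real.cos (Real.pi / n) ≤ Real.pi ^ 2 / n ^ 2 / 2 := by
    rw [div_pow] at h; linarith
  calc (1 - Real.cos (Real.pi / n)) * n ^ 2 ≤ Real.pi ^ 2 / n ^ 2 / 2 * n ^ 2 := by gcongr
    _ = Real.pi ^ 2 / 2 := by field_simp
    _ ≤ 5 := by nlinarith [Real.pi_lt_d2, Real.pi_gt_three]

/-- Half of the drift `-1` pays for at most two discrepancies, the other half for the decay term
when the separation is small compared with `n`. For large separations the cosine difference
dominates its square. -/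
lemma Close.sum_energy_le {w w' : LatticePath a b} (h : Close w w') :
    ∑ u : Update a b, (energy (step u w) (step u w') - energy w w') ≤
      -(2 * (1 - Real.cos (Real.pi / (a + b : ℕ)))) * energy w w' - 1 / 4 * discrepancy w w'
      + 2 * (1 - Real.cos (Real.pi / (a + b : ℕ))) * (10 * (a + b : ℕ) ^ 2) *
        (weight (cosine (a + b)) w' - weight (cosine (a + b)) w) := by
  rcases h with rfl | ⟨x, y, h⟩
  · simp [energy_self, discrepancy_self]
  · have h1 := h.sum_energy_le
    have h2 := h.sq_le_weight_sub
    have h3 : (discrepancy w w' : ℝ) ≤ 2 := by exact_mod_cast h.discrepancy_le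
    have hn0 : 0 < a + b := lt_of_le_of_lt (Nat.zero_le _) y.isLt
    have hn : (0 : ℝ) < (a + b : ℕ) := by exact_mod_cast hn0
    have h4 := one_sub_cos_pi_div_le hn0
    have h5 : 0 ≤ 1 - Real.cos (Real.pi / (a + b : ℕ)) := by
      linarith [Real.cos_le_one (Real.pi / (a + b : ℕ))]
    generalize hlam : 1 - Real.cos (Real.pi / (a + b : ℕ)) = lam at *
    generalize weight (cosine (a + b)) w' - weight (cosine (a + b)) w = f at *
    unfold energy at *
    generalize hd : separation w w' = d at *
    generalize ((a + b : ℕ) : ℝ) = n at *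
    obtain ⟨z, rfl⟩ : ∃ z, d = n * z := ⟨d / n, by field_simp⟩
    rw [mul_div_cancel_left₀ _ hn.ne'] at h2
    have h6 : lam * n ^ 2 * (10 * (2 * z ^ 2)) ≤ lam * n ^ 2 * (10 * f) := by gcongr
    -- With `lam * n ^ 2 ≤ 5`, the constant `1 / 20` contributes at most `1 / 2` to twice this
    -- bound; `20 * z ^ 2` is what `h6` covers.
    have h7 : lam * n ^ 2 * (z * (2 - z)) ≤ lam * n ^ 2 * (1 / 20 + 20 * z ^ 2) := by
      gcongr
      nlinarith [sq_nonneg (z - 1 / 20)]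
    have h8 : 2 * lam * (n * z * (2 * n - n * z)) = 2 * (lam * n ^ 2 * (z * (2 - z))) := by ring
    have h9 : 2 * lam * (10 * n ^ 2) * f = 2 * (lam * n ^ 2 * (10 * f)) := by ring
    rw [neg_mul, h8, h9]
    linarith

/-- A column with no discrepancy changes both weights equally. Otherwise the two changes have the
same sign and size at most `π / n`, so their difference is no larger. Two directions, and at most
two columns per position, give the factor `4`. -/
lemma sum_sq_weight_cosine_step_le (w w' : LatticePath a b) :
    ∑ u : Update a b, ((weight (cosine (a + b)) (step u w') - weight (cosine (a + b)) (step u w))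
        - (weight (cosine (a + b)) w' - weight (cosine (a + b)) w)) ^ 2 ≤
      4 * (Real.pi / (a + b : ℕ)) ^ 2 * discrepancy w w' := by
  set n := a + b with hn
  set P := (Real.pi / (n : ℕ)) ^ 2 with hP
  have hP0 : 0 ≤ P := by positivity
  let D : Fin (a + b) → ℝ := fun i => if w.1 i ≠ w'.1 i then 1 else 0
  have hD0 : ∀ i, 0 ≤ D i := fun i => by simp only [D]; split_ifs <;> norm_num
  have hDsum : ∑ i, D i = discrepancy w w' := by
    simp only [D]
    rw [Finset.sum_boole]
    rfl
  have key : ∀ e s, ((weight (cosine n) (step (e, s) w') - weight (cosine n) (step (e, s) w))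
        - (weight (cosine n) w' - weight (cosine n) w)) ^ 2 ≤
        P * (D (leftMove e) + D (rightMove e)) := by
    intro e s
    have h1 := cosine_sub_nonneg (n := n) (i := e.val) (by omega)
    have h2 := cosine_sub_le n e.val
    generalize hg : cosine n e.val - cosine n (e.val + 1) = g at h1 h2
    have hgP : g ^ 2 ≤ P := by rw [hP]; gcongr
    have hg' : cosine n (e.val + 1) - cosine n e.val = -g := by rw [← hg]; ring
    have e1 : (weight (cosine n) (step (e, s) w') - weight (cosine n) (step (e, s) w))
        - (weight (cosine n) w' - weight (cosine n) w) =
        (weight (cosine n) (step (e, s) w') - weight (cosine n) w') -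
        (weight (cosine n) (step (e, s) w) - weight (cosine n) w) := by ring
    rw [e1]
    cases s
    · rw [weight_step_false, weight_step_false, hg']
      simp only [D]
      cases w.1 (leftMove e) <;> cases w.1 (rightMove e) <;> cases w'.1 (leftMove e) <;>
        cases w'.1 (rightMove e) <;> simp <;> linarith
    · rw [weight_step_true, weight_step_true, hg]
      simp only [D]
      cases w.1 (leftMove e) <;> cases w.1 (rightMove e) <;> cases w'.1 (leftMove e) <;>
        cases w'.1 (rightMove e) <;> simp <;> linarith
  have hleft : ∑ e : Fin (a + b - 1), D (leftMove e) ≤ ∑ i, D i := by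
    rw [← Finset.sum_image (g := leftMove) (f := D) (fun i _ j _ hij => by
      simpa [leftMove, Fin.ext_iff] using hij)]
    exact Finset.sum_le_sum_of_subset_of_nonneg (Finset.subset_univ _) fun i _ _ => hD0 i
  have hright : ∑ e : Fin (a + b - 1), D (rightMove e) ≤ ∑ i, D i := by
    rw [← Finset.sum_image (g := rightMove) (f := D) (fun i _ j _ hij => by
      simpa [rightMove, Fin.ext_iff] using hij)]
    exact Finset.sum_le_sum_of_subset_of_nonneg (Finset.subset_univ _) fun i _ _ => hD0 i
  rw [Fintype.sum_prod_type]
  calc _ ≤ ∑ e : Fin (a + b - 1), 2 * (P * (D (leftMove e) + D (rightMove e))) := by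
        refine Finset.sum_le_sum fun e _ => ?_
        rw [Fintype.sum_bool]
        linarith [key e true, key e false]
    _ = 2 * P * (∑ e : Fin (a + b - 1), D (leftMove e) +
          ∑ e : Fin (a + b - 1), D (rightMove e)) := by
        rw [← Finset.sum_add_distrib, Finset.mul_sum]
        exact Finset.sum_congr rfl fun e _ => by ring
    _ ≤ 2 * P * (∑ i, D i + ∑ i, D i) := by gcongr
    _ = _ := by rw [hDsum]; ring

end Pairs
-- Expectation over the random flow, by recursion on time
section Mean

variable {a b : ℕ}

/-- The expectation of a function of the random map sending a starting path to the path at time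
`t`. -/
noncomputable def mean : ℕ → ((LatticePath a b → LatticePath a b) → ℝ) → ℝ
  | 0, g => g id
  | t + 1, g => mean t fun φ =>
      (∑ u : Update a b, g fun w => step u (φ w)) / Fintype.card (Update a b)

lemma mean_linear (t : ℕ) (α β : ℝ) (g h : (LatticePath a b → LatticePath a b) → ℝ) :
    mean t (fun φ => α * g φ + β * h φ) = α * mean t g + β * mean t h := by
  induction t generalizing g h with
  | zero => rfl
  | succ t ih =>
    simp only [mean]
    rw [← ih]
    congr 1
    funext φ
    rw [Finset.sum_add_distrib, ← Finset.mul_sum, ← Finset.mul_sum]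
    ring

lemma mean_smul (t : ℕ) (α : ℝ) (g : (LatticePath a b → LatticePath a b) → ℝ) :
    mean t (fun φ => α * g φ) = α * mean t g := by
  simpa using mean_linear t α 0 g g

/-- The inequality is needed only on maps satisfying an invariant of the dynamics, later
`PreservesClose`. -/
lemma mean_mono (p : (LatticePath a b → LatticePath a b) → Prop) (h0 : p id)
    (hp : ∀ φ, p φ → ∀ u, p fun w => step u (φ w)) (t : ℕ)
    {g h : (LatticePath a b → LatticePath a b) → ℝ} (hgh : ∀ φ, p φ → g φ ≤ h φ) :
    mean t g ≤ mean t h := by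
  induction t generalizing g h with
  | zero => exact hgh _ h0
  | succ t ih =>
    refine ih fun φ hφ => ?_
    gcongr with u
    exact hgh _ (hp φ hφ u)

lemma mean_const [NeZero a] [NeZero b] (t : ℕ) (c : ℝ) :
    mean (a := a) (b := b) t (fun _ => c) = c := by
  induction t with
  | zero => rfl
  | succ t ih =>
    simp only [mean]
    have : (Fintype.card (Update a b) : ℝ) ≠ 0 := by
      exact_mod_cast Fintype.card_ne_zero
    simpa only [Finset.sum_const, Finset.card_univ, nsmul_eq_mul,
      mul_div_cancel_left₀ _ this] using ih

end Mean

/-! ### Coalescence is permanent -/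

section Run

variable {a b : ℕ}

lemma run_congr {ω ω' : ℕ → Update a b} (w : LatticePath a b) {t : ℕ}
    (h : ∀ i < t, ω i = ω' i) : run ω w t = run ω' w t := by
  induction t with
  | zero => rfl
  | succ t ih =>
    simp only [run]
    rw [h t (Nat.lt_succ_self t), ih fun i hi => h i (Nat.lt_succ_of_lt hi)]

lemma run_eq_of_le {ω : ℕ → Update a b} {w w' : LatticePath a b} {s t : ℕ} (hst : s ≤ t)
    (h : run ω w s = run ω w' s) : run ω w t = run ω w' t := by
  induction t, hst using Nat.le_induction with
  | base => exact h
  | succ t _ ih => simp only [run]; rw [ih]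

lemma run_eq_of_coalescenceTime_lt {ω : ℕ → Update a b} {T : ENNReal} {t : ℕ}
    (hT : T ≤ ((t + 1 : ℕ) : ENNReal)) (h : ((coalescenceTime ω : ℕ∞) : ENNReal) < T) :
    run ω (top a b) t = run ω (bottom a b) t := by
  have h1 : coalescenceTime ω < ((t + 1 : ℕ) : ℕ∞) := by
    have := h.trans_le hT
    exact_mod_cast this
  unfold coalescenceTime at h1
  simp only [iInf_lt_iff] at h1
  obtain ⟨s, hs, hst⟩ := h1
  have : s < t + 1 := by exact_mod_cast hst
  exact run_eq_of_le (by omega) hs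

end Run

/-! ### The product law computes `mean` -/

section Law

variable {a b : ℕ} [NeZero a] [NeZero b]

instance : IsProbabilityMeasure (updateLaw a b) := by
  unfold updateLaw; infer_instance

/-- The path at time `t` as a function of the first `t` updates. -/
noncomputable def finiteRun (t : ℕ) (v : Finset.range t → Update a b) (w : LatticePath a b) :
    LatticePath a b :=
  run (fun i => if h : i ∈ Finset.range t then v ⟨i, h⟩ else Classical.arbitrary _) w t

lemma run_eq_finiteRun (ω : ℕ → Update a b) (t : ℕ) :
    (fun w => run ω w t) = finiteRun t fun i => ω i := by
  funext w
  refine run_congr w fun i hi => ?_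
  simp [hi]

lemma measurable_comp_run (g : (LatticePath a b → LatticePath a b) → ℝ) (t : ℕ) :
    Measurable fun ω : ℕ → Update a b => g fun w => run ω w t := by
  simp only [run_eq_finiteRun]
  have h1 : Measurable fun v : Finset.range t → Update a b => g (finiteRun t v) :=
    measurable_of_finite _
  exact h1.comp (measurable_pi_lambda _ fun i => measurable_pi_apply _)

lemma integrable_comp_run (g : (LatticePath a b → LatticePath a b) → ℝ) (t : ℕ) :
    Integrable (fun ω : ℕ → Update a b => g fun w => run ω w t) (updateLaw a b) := by
  refine Integrable.of_bound (measurable_comp_run g t).aestronglyMeasurable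
    (∑ v : Finset.range t → Update a b, ‖g (finiteRun t v)‖) (Eventually.of_forall fun ω => ?_)
  rw [run_eq_finiteRun]
  exact Finset.single_le_sum (f := fun v => ‖g (finiteRun t v)‖) (fun _ _ => norm_nonneg _)
    (Finset.mem_univ _)

lemma updateLaw_eval (t : ℕ) (u : Update a b) :
    ∫ ω, (if ω t = u then (1 : ℝ) else 0) ∂updateLaw a b =
      (Fintype.card (Update a b) : ℝ)⁻¹ := by
  have hm := measurePreserving_eval_infinitePi
    (fun _ : ℕ => (PMF.uniformOfFintype (Update a b)).toMeasure) t
  have hf : Measurable fun v : Update a b => if v = u then (1 : ℝ) else 0 := measurable_of_finite _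
  have h := integral_map (μ := updateLaw a b) hm.measurable.aemeasurable
    (f := fun v => if v = u then (1 : ℝ) else 0) hf.aestronglyMeasurable
  have h2 : (updateLaw a b).map (Function.eval t) =
    (PMF.uniformOfFintype (Update a b)).toMeasure := hm.map_eq
  rw [h2] at h
  rw [show (fun ω : ℕ → Update a b => if ω t = u then (1 : ℝ) else 0) =
    fun ω => if Function.eval t ω = u then (1 : ℝ) else 0 from rfl, ← h, PMF.integral_eq_sum]
  simp [PMF.uniformOfFintype_apply, -Fintype.card_prod]

/-- Split according to the value of the last update, which is independent of the finitely many
earlier ones that determine the current flow. -/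
lemma integral_comp_run_succ (g : (LatticePath a b → LatticePath a b) → ℝ) (t : ℕ) :
    ∫ ω, g (fun w => run ω w (t + 1)) ∂updateLaw a b =
      ∫ ω, (∑ u : Update a b, g fun w => step u (run ω w t)) / Fintype.card (Update a b)
        ∂updateLaw a b := by
  have hind : ProbabilityTheory.iIndepFun (fun (i : ℕ) (ω : ℕ → Update a b) => ω i)
      (updateLaw a b) :=
    ProbabilityTheory.iIndepFun_infinitePi (X := fun (_ : ℕ) (v : Update a b) => v)
      (fun _ => measurable_id)
  have hind2 := hind.indepFun_finset (Finset.range t) {t} (by simp) fun i => measurable_pi_apply i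
  have h1 : ∀ ω : ℕ → Update a b, g (fun w => run ω w (t + 1)) =
      ∑ u : Update a b, g (fun w => step u (run ω w t)) * if ω t = u then (1 : ℝ) else 0 := by
    intro ω
    simp [run]
  have hint : ∀ u : Update a b, Integrable (fun ω : ℕ → Update a b =>
      g (fun w => step u (run ω w t))) (updateLaw a b) := fun u =>
    integrable_comp_run (fun φ => g fun w => step u (φ w)) t
  have hmeas : ∀ u : Update a b, Measurable fun ω : ℕ → Update a b =>
      if ω t = u then (1 : ℝ) else 0 := fun u =>
    (measurable_of_finite (fun v : Update a b => if v = u then (1 : ℝ) else 0)).comp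
      (measurable_pi_apply t)
  have hprod : ∀ u : Update a b,
      ∫ ω, g (fun w => step u (run ω w t)) * (if ω t = u then (1 : ℝ) else 0) ∂updateLaw a b =
      (∫ ω, g (fun w => step u (run ω w t)) ∂updateLaw a b) *
        (Fintype.card (Update a b) : ℝ)⁻¹ := by
    intro u
    rw [← updateLaw_eval t u]
    refine ProbabilityTheory.IndepFun.integral_fun_mul_eq_mul_integral ?_
      (hint u).aestronglyMeasurable (hmeas u).aestronglyMeasurable
    have := hind2.comp
      (φ := fun v : Finset.range t → Update a b => g fun w => step u (finiteRun t v w))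
      (ψ := fun v : ({t} : Finset ℕ) → Update a b =>
        if v ⟨t, Finset.mem_singleton_self t⟩ = u then (1 : ℝ) else 0)
      (measurable_of_finite _) (measurable_of_finite _)
    have e : (fun ω : ℕ → Update a b => g fun w => step u (run ω w t)) =
        fun ω => g fun w => step u (finiteRun t (fun i => ω i) w) := by
      funext ω
      exact congrArg (fun φ : LatticePath a b → LatticePath a b => g fun w => step u (φ w))
        (run_eq_finiteRun ω t)
    rw [e]
    exact this
  simp only [h1]
  rw [integral_finsetSum, integral_div, integral_finsetSum _ fun u _ => hint u,
    Finset.sum_congr rfl fun u _ => hprod u, ← Finset.sum_mul, div_eq_mul_inv]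
  intro u _
  refine (hint u).mul_bdd (c := 1) (hmeas u).aestronglyMeasurable (Eventually.of_forall fun ω => ?_)
  split_ifs <;> simp

lemma integral_comp_run (g : (LatticePath a b → LatticePath a b) → ℝ) (t : ℕ) :
    ∫ ω, g (fun w => run ω w t) ∂updateLaw a b = mean t g := by
  induction t generalizing g with
  | zero =>
    have : ∀ ω : ℕ → Update a b, (fun w => run ω w 0) = id := fun ω => rfl
    simp [mean, this]
  | succ t ih =>
    rw [integral_comp_run_succ]
    exact ih fun φ => (∑ u : Update a b, g fun w => step u (φ w)) / Fintype.card (Update a b)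

open scoped Classical in
lemma measureReal_run_eq (w w' : LatticePath a b) (t : ℕ) :
    (updateLaw a b).real {ω | run ω w t = run ω w' t} =
      mean t fun φ => if φ w = φ w' then 1 else 0 := by
  rw [← integral_comp_run, ← integral_indicator_one]
  · refine integral_congr_ae (Eventually.of_forall fun ω => ?_)
    simp [Set.indicator_apply]
  · have h := measurable_comp_run (a := a) (b := b) (fun φ => if φ w = φ w' then 1 else 0) t
      (measurableSet_singleton 1)
    convert h using 1
    ext ω
    simp

lemma measurableSet_run_eq (w w' : LatticePath a b) (t : ℕ) :
    MeasurableSet {ω : ℕ → Update a b | run ω w t = run ω w' t} := by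
  classical
  have h := measurable_comp_run (a := a) (b := b) (fun φ => if φ w = φ w' then 1 else 0) t
    (measurableSet_singleton 1)
  convert h using 1
  ext ω
  simp

end Law
-- Interpolation between the extremal paths
section Chain

/-- Paths interpolating between the bottommost and the topmost path: the first `k` down moves have
been exchanged with the first `k` up moves. -/
def chain (m : ℕ) : ℕ → LatticePath m m
  | 0 => bottom m m
  | k + 1 =>
    if h : k < m then
      ⟨fun i => (chain m k).1 (Equiv.swap (⟨k, by omega⟩ : Fin (m + m)) ⟨m + k, by omega⟩ i), by
        refine Eq.trans (Finset.card_equiv (Equiv.swap (⟨k, by omega⟩ : Fin (m + m))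
          ⟨m + k, by omega⟩) ?_) (chain m k).2
        intro i
        simp⟩
    else chain m k

lemma chain_apply {m k : ℕ} (hk : k ≤ m) (i : Fin (m + m)) :
    (chain m k).1 i = decide (i.val < k ∨ m + k ≤ i.val) := by
  induction k generalizing i with
  | zero => simp [chain, bottom]
  | succ k ih =>
    have hkm : k < m := hk
    have e : (chain m (k + 1)).1 i =
        (chain m k).1 (Equiv.swap (⟨k, by omega⟩ : Fin (m + m)) ⟨m + k, by omega⟩ i) :=
      congrArg (fun w : LatticePath m m => w.1 i) (dif_pos hkm)
    rw [e, ih (by omega), Equiv.swap_apply_def]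
    split_ifs with h1 h2
    · subst h1
      rw [decide_eq_true (by simp), decide_eq_true (by simp)]
    · subst h2
      rw [decide_eq_false (by simp only; omega), decide_eq_false (by simp only; omega)]
    · have h1' : i.val ≠ k := fun h => h1 (Fin.ext h)
      have h2' : i.val ≠ m + k := fun h => h2 (Fin.ext h)
      rw [decide_eq_decide]
      omega

lemma chain_self (m : ℕ) : chain m m = top m m := by
  apply Subtype.ext
  funext i
  rw [chain_apply le_rfl]
  simp only [top]
  rw [decide_eq_decide]
  omega

lemma chain_differ {m k : ℕ} (hk : k < m) :
    Differ (chain m k) (chain m (k + 1)) ⟨k, by omega⟩ ⟨m + k, by omega⟩ where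
  lt := by rw [Fin.lt_def]; simp only; omega
  left := by rw [chain_apply hk.le]; simp only; rw [decide_eq_false]; omega
  left' := by rw [chain_apply hk]; simp only; rw [decide_eq_true]; omega
  right := by rw [chain_apply hk.le]; simp only; rw [decide_eq_true]; omega
  right' := by rw [chain_apply hk]; simp only; rw [decide_eq_false]; omega
  off i h1 h2 := by
    have h1' : i.val ≠ k := fun h => h1 (Fin.ext h)
    have h2' : i.val ≠ m + k := fun h => h2 (Fin.ext h)
    rw [chain_apply hk.le, chain_apply hk, decide_eq_decide]
    omega

end Chain

/-! ### The potential and its drift -/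

section Potential

variable {m : ℕ}

/-- The projection of the gap between the extremal paths on the slowest mode. -/
noncomputable def gap (φ : LatticePath m m → LatticePath m m) : ℝ :=
  weight (cosine (m + m)) (φ (top m m)) - weight (cosine (m + m)) (φ (bottom m m))

/-- The sum of the energies of the pairs of neighbouring interpolating paths. -/
noncomputable def totalEnergy (φ : LatticePath m m → LatticePath m m) : ℝ :=
  ∑ k ∈ Finset.range m, energy (φ (chain m k)) (φ (chain m (k + 1)))

/-- The sum of the discrepancies of the pairs of neighbouring interpolating paths. -/
noncomputable def totalDiscrepancy (φ : LatticePath m m → LatticePath m m) : ℝ :=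
  ∑ k ∈ Finset.range m, (discrepancy (φ (chain m k)) (φ (chain m (k + 1))) : ℝ)

/-- Neighbouring interpolating paths are mapped to close paths. -/
def PreservesClose (φ : LatticePath m m → LatticePath m m) : Prop :=
  ∀ k < m, Close (φ (chain m k)) (φ (chain m (k + 1)))

lemma preservesClose_id : PreservesClose (m := m) id :=
  fun _ hk => Or.inr ⟨_, _, chain_differ hk⟩

lemma PreservesClose.step_comp {φ : LatticePath m m → LatticePath m m} (h : PreservesClose φ)
    (u : Update m m) : PreservesClose fun w => step u (φ w) :=
  fun k hk => (h k hk).step_close u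

lemma gap_eq_sum (φ : LatticePath m m → LatticePath m m) :
    gap φ = ∑ k ∈ Finset.range m, (weight (cosine (m + m)) (φ (chain m (k + 1))) -
      weight (cosine (m + m)) (φ (chain m k))) := by
  rw [Finset.sum_range_sub (fun k => weight (cosine (m + m)) (φ (chain m k))), chain_self]
  rfl

lemma discrepancy_le_total (φ : LatticePath m m → LatticePath m m) :
    (discrepancy (φ (bottom m m)) (φ (top m m)) : ℝ) ≤ totalDiscrepancy φ := by
  have h : ∀ K, (discrepancy (φ (chain m 0)) (φ (chain m K)) : ℝ) ≤
      ∑ k ∈ Finset.range K, (discrepancy (φ (chain m k)) (φ (chain m (k + 1))) : ℝ) := by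
    intro K
    induction K with
    | zero => simp [discrepancy_self]
    | succ K ih =>
      rw [Finset.sum_range_succ]
      have := hammingDist_triangle (φ (chain m 0)).1 (φ (chain m K)).1 (φ (chain m (K + 1))).1
      have h2 : (discrepancy (φ (chain m 0)) (φ (chain m (K + 1))) : ℝ) ≤
          discrepancy (φ (chain m 0)) (φ (chain m K)) +
          discrepancy (φ (chain m K)) (φ (chain m (K + 1))) := by exact_mod_cast this
      linarith
  have := h m
  rwa [chain_self] at this

lemma totalEnergy_id : totalEnergy (m := m) id = 3 * (m : ℝ) ^ 3 := by
  have : ∀ k ∈ Finset.range m, energy (id (chain m k)) (id (chain m (k + 1))) = 3 * (m : ℝ) ^ 2 := by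
    intro k hk
    have h := (chain_differ (Finset.mem_range.1 hk)).separation_eq
    simp only [id, energy]
    rw [h]
    push_cast
    ring
  unfold totalEnergy
  rw [Finset.sum_congr rfl this]
  simp
  ring

/-- The spectral gap of the chain. -/
noncomputable def rate (m : ℕ) : ℝ :=
  2 * (1 - Real.cos (Real.pi / (m + m : ℕ))) / Fintype.card (Update m m)

lemma sum_gap_step (hm : 1 ≤ m) (φ : LatticePath m m → LatticePath m m) :
    ∑ u : Update m m, (gap (fun w => step u (φ w)) - gap φ) =
      -(2 * (1 - Real.cos (Real.pi / (m + m : ℕ)))) * gap φ := by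
  have h1 := sum_weight_cosine_step (φ (top m m)) (by omega)
  have h2 := sum_weight_cosine_step (φ (bottom m m)) (by omega)
  unfold gap
  rw [mul_sub, ← h1, ← h2, ← Finset.sum_sub_distrib]
  exact Finset.sum_congr rfl fun u _ => by ring

lemma card_update_pos [NeZero m] : (0 : ℝ) < Fintype.card (Update m m) := by
  exact_mod_cast Fintype.card_pos

lemma average_gap_step [NeZero m] (φ : LatticePath m m → LatticePath m m) :
    (∑ u : Update m m, gap (fun w => step u (φ w))) / Fintype.card (Update m m) =
      (1 - rate m) * gap φ := by
  have h := sum_gap_step (Nat.one_le_iff_ne_zero.2 (NeZero.ne m)) φ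
  have hN := card_update_pos (m := m)
  rw [Finset.sum_sub_distrib, Finset.sum_const, Finset.card_univ, nsmul_eq_mul] at h
  unfold rate
  generalize (Fintype.card (Update m m) : ℝ) = N at *
  field_simp
  linear_combination h

/-- A function controlling the second moment of the gap. -/
noncomputable def potential (φ : LatticePath m m → LatticePath m m) : ℝ :=
  gap φ ^ 2 + 16 * (Real.pi / (m + m : ℕ)) ^ 2 * totalEnergy φ

lemma average_potential_step_le [NeZero m] {φ : LatticePath m m → LatticePath m m}
    (hφ : PreservesClose φ) :
    (∑ u : Update m m, potential (fun w => step u (φ w))) / Fintype.card (Update m m) ≤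
      (1 - rate m) * potential φ - rate m * gap φ ^ 2 +
        160 * Real.pi ^ 2 * rate m * gap φ := by
  have hm : m ≠ 0 := NeZero.ne m
  have hn : (0 : ℝ) < (m + m : ℕ) := by
    have : 0 < m + m := by omega
    exact_mod_cast this
  have hN := card_update_pos (m := m)
  have h1 := sum_gap_step (Nat.one_le_iff_ne_zero.2 hm) φ
  have h2 : ∑ u : Update m m, (gap (fun w => step u (φ w)) - gap φ) ^ 2 ≤
      4 * (Real.pi / (m + m : ℕ)) ^ 2 * totalDiscrepancy φ :=
    (sum_sq_weight_cosine_step_le (φ (bottom m m)) (φ (top m m))).trans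
      (by gcongr; exact discrepancy_le_total φ)
  have h3 : ∑ u : Update m m, (totalEnergy (fun w => step u (φ w)) - totalEnergy φ) ≤
      -(2 * (1 - Real.cos (Real.pi / (m + m : ℕ)))) * totalEnergy φ - 1 / 4 * totalDiscrepancy φ
      + 2 * (1 - Real.cos (Real.pi / (m + m : ℕ))) * (10 * (m + m : ℕ) ^ 2) * gap φ := by
    rw [gap_eq_sum]
    unfold totalEnergy totalDiscrepancy
    simp only [← Finset.sum_sub_distrib, Finset.mul_sum, ← Finset.sum_add_distrib]
    rw [Finset.sum_comm]
    exact Finset.sum_le_sum fun k hk => (hφ k (Finset.mem_range.1 hk)).sum_energy_le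
  have h4 : ∑ u : Update m m, potential (fun w => step u (φ w)) =
      Fintype.card (Update m m) * potential φ +
      2 * gap φ * ∑ u : Update m m, (gap (fun w => step u (φ w)) - gap φ) +
      ∑ u : Update m m, (gap (fun w => step u (φ w)) - gap φ) ^ 2 +
      16 * (Real.pi / (m + m : ℕ)) ^ 2 *
        ∑ u : Update m m, (totalEnergy (fun w => step u (φ w)) - totalEnergy φ) := by
    rw [← nsmul_eq_mul, ← Finset.card_univ, ← Finset.sum_const, Finset.mul_sum, Finset.mul_sum,
      ← Finset.sum_add_distrib, ← Finset.sum_add_distrib, ← Finset.sum_add_distrib]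
    refine Finset.sum_congr rfl fun u _ => ?_
    unfold potential
    ring
  rw [h4, h1]
  -- The factor `16` turns the `-1 / 4` in `h3` into `-4`, cancelling the noise bound `h2` exactly.
  have h5 := mul_le_mul_of_nonneg_left h3
    (by positivity : 0 ≤ 16 * (Real.pi / (m + m : ℕ)) ^ 2)
  unfold rate
  rw [div_le_iff₀ hN]
  unfold potential
  have h6 : 16 * (Real.pi / (m + m : ℕ)) ^ 2 *
      (2 * (1 - Real.cos (Real.pi / (m + m : ℕ))) * (10 * (m + m : ℕ) ^ 2) * gap φ) =
      160 * Real.pi ^ 2 * (2 * (1 - Real.cos (Real.pi / (m + m : ℕ)))) * gap φ := by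
    field_simp; ring
  generalize Real.cos (Real.pi / (m + m : ℕ)) = C at *
  generalize (Fintype.card (Update m m) : ℝ) = N at *
  generalize (Real.pi / (m + m : ℕ)) ^ 2 = P at *
  have h7 : ((1 - 2 * (1 - C) / N) * (gap φ ^ 2 + 16 * P * totalEnergy φ) -
      2 * (1 - C) / N * gap φ ^ 2 + 160 * Real.pi ^ 2 * (2 * (1 - C) / N) * gap φ) * N =
      N * (gap φ ^ 2 + 16 * P * totalEnergy φ) - 2 * (1 - C) * (gap φ ^ 2 + 16 * P * totalEnergy φ)
      - 2 * (1 - C) * gap φ ^ 2 + 160 * Real.pi ^ 2 * (2 * (1 - C)) * gap φ := by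
    field_simp
  rw [h7]
  linarith

lemma mean_potential (t : ℕ) :
    mean t (potential (m := m)) = mean t (fun φ => gap (m := m) φ ^ 2) +
      16 * (Real.pi / (m + m : ℕ)) ^ 2 * mean t (totalEnergy (m := m)) := by
  have := mean_linear (a := m) (b := m) t 1 (16 * (Real.pi / (m + m : ℕ)) ^ 2)
    (fun φ => gap φ ^ 2) totalEnergy
  simp only [one_mul] at this
  exact this

end Potential

/-! ### Second moment bound and Chebyshev's inequality -/

section Moments

variable {m : ℕ} [NeZero m]

lemma mean_gap (t : ℕ) : mean t (gap (m := m)) = (1 - rate m) ^ t * gap (m := m) id := by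
  induction t with
  | zero => simp [mean]
  | succ t ih =>
    simp only [mean, average_gap_step]
    rw [mean_smul, ih]
    ring

lemma sq_mean_le (t : ℕ) (g : (LatticePath m m → LatticePath m m) → ℝ) :
    mean t g ^ 2 ≤ mean t fun φ => g φ ^ 2 := by
  have h : mean (a := m) (b := m) t (fun _ => 0) ≤
      mean t (fun φ => 1 * g φ ^ 2 + 1 * (-(2 * mean t g) * g φ + mean t g ^ 2 * 1)) :=
    mean_mono (fun _ => True) trivial (fun _ _ _ => trivial) t
      fun φ _ => by nlinarith [sq_nonneg (g φ - mean t g)]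
  rw [mean_linear, mean_linear, mean_const, mean_const] at h
  nlinarith

lemma rate_nonneg : 0 ≤ rate m := by
  unfold rate
  have := Real.cos_le_one (Real.pi / (m + m : ℕ))
  have hN := card_update_pos (m := m)
  apply div_nonneg <;> linarith

lemma mean_totalEnergy_nonneg (t : ℕ) : 0 ≤ mean t (totalEnergy (m := m)) := by
  rw [← mean_const (a := m) (b := m) t 0]
  exact mean_mono PreservesClose preservesClose_id (fun φ h u => h.step_comp u) t
    fun φ h => Finset.sum_nonneg fun k hk => (h k (Finset.mem_range.1 hk)).energy_nonneg

lemma mean_potential_succ_le (t : ℕ) :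
    mean (t + 1) (potential (m := m)) ≤ (1 - rate m) * mean t (potential (m := m)) -
      rate m * mean t (fun φ => gap (m := m) φ ^ 2) +
        160 * Real.pi ^ 2 * rate m * mean t (gap (m := m)) := by
  have h : mean (t + 1) (potential (m := m)) ≤ mean t (fun φ : LatticePath m m → LatticePath m m =>
      (1 - rate m) * potential φ +
      1 * (-rate m * gap φ ^ 2 + 160 * Real.pi ^ 2 * rate m * gap φ)) := by
    simp only [mean]
    refine mean_mono PreservesClose preservesClose_id (fun φ h u => h.step_comp u) t fun φ h => ?_
    refine (average_potential_step_le h).trans (le_of_eq ?_)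
    ring
  rw [mean_linear, mean_linear] at h
  linarith

/-- The forcing term is proportional to the mean gap, which decays at the same rate as the
homogeneous solution; this resonance costs the factor `t`. The extra `1 - rate m` on both sides
avoids the exponent `t - 1`. -/
lemma variance_bound (hr : 0 ≤ 1 - rate m) (t : ℕ) :
    (1 - rate m) * (mean t (potential (m := m)) - mean t (gap (m := m)) ^ 2) ≤
      (1 - rate m) ^ t * ((1 - rate m) * (16 * (Real.pi / (m + m : ℕ)) ^ 2 *
        totalEnergy (m := m) id) + t * (160 * Real.pi ^ 2 * rate m * gap (m := m) id)) := by
  induction t with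
  | zero =>
    simp only [mean, potential]
    apply le_of_eq
    push_cast
    ring
  | succ t ih =>
    have h1 := mean_potential_succ_le (m := m) t
    have h2 := sq_mean_le t (gap (m := m))
    have h3 : mean (t + 1) (gap (m := m)) = (1 - rate m) * mean t (gap (m := m)) := by
      rw [mean_gap, mean_gap]; ring
    have h4 := mean_gap (m := m) t
    have h0 := rate_nonneg (m := m)
    rw [h3]
    generalize rate m = γ at *
    -- By Jensen the additional loss `γ * E[gap²]` is at least `γ * (E gap)²`; the squared means
    -- then combine to `-γ² * (E gap)²`, which is dropped.
    have h5 : mean (t + 1) (potential (m := m)) - ((1 - γ) * mean t (gap (m := m))) ^ 2 ≤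
        (1 - γ) * (mean t (potential (m := m)) - mean t (gap (m := m)) ^ 2) +
        160 * Real.pi ^ 2 * γ * mean t (gap (m := m)) := by
      nlinarith [mul_le_mul_of_nonneg_left h2 h0, sq_nonneg (γ * mean t (gap (m := m)))]
    have h6 := mul_le_mul_of_nonneg_left (h5.trans (add_le_add_left ih _)) hr
    refine h6.trans (le_of_eq ?_)
    rw [h4]
    push_cast
    ring

open scoped Classical in
-- On coalescence the gap is zero, so its squared deviation is the squared mean. The energy part of
-- the potential is nonnegative and only weakens the bound.
lemma coalesced_mul_sq_le (t : ℕ) :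
    (mean t fun φ : LatticePath m m → LatticePath m m =>
      if φ (top m m) = φ (bottom m m) then (1 : ℝ) else 0) * mean t (gap (m := m)) ^ 2 ≤
      mean t (potential (m := m)) - mean t (gap (m := m)) ^ 2 := by
  set M := mean t (gap (m := m)) with hM
  have h : mean t (fun φ : LatticePath m m → LatticePath m m =>
      M ^ 2 * if φ (top m m) = φ (bottom m m) then (1 : ℝ) else 0) ≤
      mean t (fun φ => 1 * gap (m := m) φ ^ 2 + 1 * (-(2 * M) * gap φ + M ^ 2 * 1)) := by
    refine mean_mono (fun _ => True) trivial (fun _ _ _ => trivial) t fun φ _ => ?_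
    split_ifs with hc
    · have : gap φ = 0 := by simp [gap, hc]
      rw [this]; apply le_of_eq; ring
    · nlinarith [sq_nonneg (gap φ - M)]
  rw [mean_smul, mean_linear, mean_linear, mean_const, ← hM] at h
  have h2 := mean_potential (m := m) t
  have h3 : 0 ≤ 16 * (Real.pi / (m + m : ℕ)) ^ 2 * mean t (totalEnergy (m := m)) :=
    mul_nonneg (by positivity) (mean_totalEnergy_nonneg t)
  nlinarith

lemma half_le_gap_id : (m : ℝ) / 2 ≤ gap (m := m) id := by
  have hm : (0 : ℝ) < m := by exact_mod_cast Nat.pos_of_ne_zero (NeZero.ne m)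
  rw [gap_eq_sum]
  have : ∀ k ∈ Finset.range m, (1 / 2 : ℝ) ≤ weight (cosine (m + m)) (id (chain m (k + 1))) -
      weight (cosine (m + m)) (id (chain m k)) := by
    intro k hk
    have h := chain_differ (Finset.mem_range.1 hk)
    refine le_trans (le_of_eq ?_) h.sq_le_weight_sub
    rw [h.separation_eq]
    push_cast
    field_simp
    ring
  refine le_trans (le_of_eq ?_) (Finset.sum_le_sum this)
  simp
  ring

lemma coalesced_probability_le (hr : 0 < 1 - rate m) (t : ℕ) :
    (updateLaw m m).real {ω | run ω (top m m) t = run ω (bottom m m) t} ≤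
      Real.exp (t * (rate m / (1 - rate m))) *
        (480 + 3200 * (t * (rate m / (1 - rate m)))) / m := by
  classical
  have hm : (0 : ℝ) < m := by exact_mod_cast Nat.pos_of_ne_zero (NeZero.ne m)
  rw [measureReal_run_eq]
  have h1 := coalesced_mul_sq_le (m := m) t
  have h2 := variance_bound hr.le t
  have h3 := half_le_gap_id (m := m)
  rw [totalEnergy_id] at h2
  rw [mean_gap] at h1 h2
  have hγ := rate_nonneg (m := m)
  have hpi : Real.pi ^ 2 ≤ 10 := by nlinarith [Real.pi_lt_d2, Real.pi_gt_three]
  have hK : 16 * (Real.pi / (m + m : ℕ)) ^ 2 * (3 * (m : ℝ) ^ 3) ≤ 120 * m := by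
    have : 16 * (Real.pi / (m + m : ℕ)) ^ 2 * (3 * (m : ℝ) ^ 3) = 12 * Real.pi ^ 2 * m := by
      push_cast; field_simp; ring
    rw [this]
    nlinarith
  generalize 16 * (Real.pi / (m + m : ℕ)) ^ 2 * (3 * (m : ℝ) ^ 3) = E at *
  generalize gap (m := m) id = M at *
  generalize rate m = γ at *
  generalize (mean t fun φ : LatticePath m m → LatticePath m m =>
      if φ (top m m) = φ (bottom m m) then (1 : ℝ) else 0) = p at *
  set r := 1 - γ with hrdef
  have hM : 0 < M := lt_of_lt_of_le (by positivity) h3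
  have hrt : 0 < r ^ t := pow_pos hr t
  have hexp : 1 ≤ r ^ t * Real.exp (t * (γ / r)) := by
    have h : 1 ≤ r * Real.exp (γ / r) := by
      have := Real.add_one_le_exp (γ / r)
      calc (1 : ℝ) = r * (γ / r + 1) := by field_simp; rw [hrdef]; ring
        _ ≤ _ := by gcongr
    rw [Real.exp_nat_mul, ← mul_pow]
    exact one_le_pow₀ h
  have ht : (0 : ℝ) ≤ t := Nat.cast_nonneg t
  have hmain : p * r ^ t * M ^ 2 ≤ E + t * (γ / r) * (1600 * M) := by
    have h4 := (mul_le_mul_of_nonneg_left h1 hr.le).trans h2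
    have h5 : r ^ t * (r * (p * r ^ t * M ^ 2)) ≤
        r ^ t * (r * (E + t * (γ / r) * (160 * Real.pi ^ 2 * M))) := by
      refine le_trans (le_of_eq ?_) (h4.trans (le_of_eq ?_))
      · ring
      · field_simp
    have h6 := le_of_mul_le_mul_left (le_of_mul_le_mul_left h5 hrt) hr
    refine h6.trans ?_
    gcongr
    nlinarith
  have hx : 0 ≤ t * (γ / r) := by positivity
  generalize t * (γ / r) = x at *
  have h7 : p * r ^ t ≤ (480 + 3200 * x) / m := by
    -- Both constants come from `M ≥ m / 2`: `120 * m / (m / 2) ^ 2 = 480 / m` and `1600 / (m / 2) =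
    -- 3200 / m`.
    have e1 : E + x * (1600 * M) ≤ (480 + 3200 * x) / m * M ^ 2 := by
      have e2 : 480 / m * M ^ 2 ≥ 120 * m := by
        have : 480 / m * M ^ 2 ≥ 480 / m * ((m : ℝ) / 2) ^ 2 := by gcongr
        refine le_trans (le_of_eq ?_) this
        field_simp; ring
      have e3 : 3200 / m * M ^ 2 ≥ 1600 * M := by
        have : 3200 / m * (M * M) ≥ 3200 / m * ((m : ℝ) / 2 * M) := by gcongr
        rw [sq]
        refine le_trans (le_of_eq ?_) this
        field_simp; ring
      have e4 : (480 + 3200 * x) / m * M ^ 2 = 480 / m * M ^ 2 + x * (3200 / m * M ^ 2) := by ring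
      have e5 : x * (1600 * M) ≤ x * (3200 / m * M ^ 2) := by gcongr
      linarith
    exact le_of_mul_le_mul_right (hmain.trans e1) (by positivity)
  by_cases hp : 0 ≤ p
  · calc p ≤ p * (r ^ t * Real.exp x) := le_mul_of_one_le_right hp hexp
      _ = Real.exp x * (p * r ^ t) := by ring
      _ ≤ Real.exp x * ((480 + 3200 * x) / m) := by gcongr
      _ = _ := by ring
  · exact (not_le.1 hp).le.trans (by positivity)

end Moments

/-! ### Asymptotics at the critical time scale -/

section Asymptotics

lemma rate_div_le {m : ℕ} (hm : 2 ≤ m) :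
    0 < 1 - rate m ∧ rate m / (1 - rate m) ≤
      Real.pi ^ 2 / (2 * ((2 * m : ℕ) : ℝ) ^ 2 * (((2 * m : ℕ) : ℝ) - 2)) := by
  have hcard : (Fintype.card (Update m m) : ℝ) = (((2 * m : ℕ) : ℝ) - 1) * 2 := by
    have : Fintype.card (Update m m) = (2 * m - 1) * 2 := by simp; omega
    rw [this, Nat.cast_mul, Nat.cast_sub (by omega)]
    simp
  have hn : (4 : ℝ) ≤ (2 * m : ℕ) := by
    have : 4 ≤ 2 * m := by omega
    exact_mod_cast this
  have e : rate m = (1 - Real.cos (Real.pi / (2 * m : ℕ))) / (((2 * m : ℕ) : ℝ) - 1) := by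
    unfold rate
    rw [hcard, ← two_mul]
    have : ((2 * m : ℕ) : ℝ) - 1 ≠ 0 := by linarith
    field_simp
  rw [e]
  have h := Real.one_sub_sq_div_two_le_cos (x := Real.pi / (2 * m : ℕ))
  generalize ((2 * m : ℕ) : ℝ) = n at *
  have h1 : 1 - Real.cos (Real.pi / n) ≤ Real.pi ^ 2 / (2 * n ^ 2) := by
    have : Real.pi ^ 2 / (2 * n ^ 2) = (Real.pi / n) ^ 2 / 2 := by field_simp
    rw [this]; linarith
  have h2 : 1 - Real.cos (Real.pi / n) ≤ 1 := by
    have : 0 ≤ Real.cos (Real.pi / n) := by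
      apply Real.cos_nonneg_of_neg_pi_div_two_le_of_le
      · have : 0 ≤ Real.pi / n := by positivity
        linarith [Real.pi_pos]
      · have := Real.pi_pos
        gcongr; linarith
    linarith
  have h3 : 0 ≤ 1 - Real.cos (Real.pi / n) := by linarith [Real.cos_le_one (Real.pi / n)]
  generalize 1 - Real.cos (Real.pi / n) = lam at *
  have hn1 : 0 < n - 1 := by linarith
  have hn2 : 0 < n - 2 := by linarith
  have e2 : 1 - lam / (n - 1) = (n - 1 - lam) / (n - 1) := by field_simp
  have h4 : 0 < n - 1 - lam := by linarith
  rw [e2]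
  refine ⟨by positivity, ?_⟩
  calc lam / (n - 1) / ((n - 1 - lam) / (n - 1)) = lam / (n - 1 - lam) := by field_simp
    _ ≤ (Real.pi ^ 2 / (2 * n ^ 2)) / (n - 2) :=
      div_le_div₀ (by positivity) h1 hn2 (by linarith)
    _ = _ := by rw [div_div]

lemma coalesced_probability_le_log {m : ℕ} [NeZero m] (hm : 2 ≤ m) {t : ℕ}
    (ht : (t : ℝ) ≤ (1 - 1 / √(Real.log ((2 * m : ℕ) : ℝ))) *
      (2 / Real.pi ^ 2 * ((2 * m : ℕ) : ℝ) ^ 3 * Real.log ((2 * m : ℕ) : ℝ))) :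
    (updateLaw m m).real {ω | run ω (top m m) t = run ω (bottom m m) t} ≤
      Real.exp 4 * 32960 *
        (√(Real.log ((2 * m : ℕ) : ℝ)) ^ 2 * Real.exp (-√(Real.log ((2 * m : ℕ) : ℝ)))) := by
  obtain ⟨hr, hx⟩ := rate_div_le hm
  refine (coalesced_probability_le hr t).trans ?_
  have hn : (4 : ℝ) ≤ (2 * m : ℕ) := by
    have : 4 ≤ 2 * m := by omega
    exact_mod_cast this
  have hnm : (m : ℝ) = ((2 * m : ℕ) : ℝ) / 2 := by push_cast; ring
  rw [hnm]
  have hx0 : 0 ≤ rate m / (1 - rate m) := div_nonneg rate_nonneg hr.le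
  generalize rate m / (1 - rate m) = y at *
  generalize ((2 * m : ℕ) : ℝ) = n at *
  have hn0 : 0 < n := by linarith
  have hexpL := Real.exp_log hn0
  have hL1 : 1 ≤ Real.log n := by
    rw [Real.le_log_iff_exp_le hn0]
    linarith [Real.exp_one_lt_d9]
  have hLn : Real.log n ≤ n - 1 := Real.log_le_sub_one_of_pos hn0
  generalize Real.log n = L at *
  have hs := Real.sq_sqrt (by linarith : 0 ≤ L)
  have hs1 : 1 ≤ √L := Real.one_le_sqrt.2 hL1
  generalize √L = s at *
  subst hs
  have hs0 : 0 < s := by linarith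
  have hn2 : 0 < n - 2 := by linarith
  have hpi := Real.pi_pos
  have h1s : 0 ≤ 1 - 1 / s := by
    rw [sub_nonneg, div_le_one hs0]; exact hs1
  -- The time scale cancels the rate up to the factor `n / (n - 2)`, which costs only a constant
  -- because `s ^ 2 = log n ≤ n - 1`.
  have hty : t * y ≤ s ^ 2 - s + 4 := by
    calc t * y ≤ ((1 - 1 / s) * (2 / Real.pi ^ 2 * n ^ 3 * s ^ 2)) *
          (Real.pi ^ 2 / (2 * n ^ 2 * (n - 2))) := by gcongr
      _ = (s ^ 2 - s) * (1 + 2 / (n - 2)) := by field_simp; ring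
      _ ≤ s ^ 2 - s + 4 := by
        have : (s ^ 2 - s) * (2 / (n - 2)) ≤ 4 := by
          rw [mul_div_assoc', div_le_iff₀ hn2]
          nlinarith
        linarith
  have hty0 : 0 ≤ t * y := by positivity
  calc Real.exp (t * y) * (480 + 3200 * (t * y)) / (n / 2)
      ≤ Real.exp (s ^ 2 - s + 4) * (16480 * s ^ 2) / (n / 2) := by
        gcongr
        nlinarith
    -- Since `exp (s ^ 2) = n`, the division by `n / 2` leaves only `exp (-s)` and a factor `2`.
    _ = Real.exp 4 * 32960 * (s ^ 2 * Real.exp (-s)) := by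
        rw [show s ^ 2 - s + 4 = s ^ 2 + -s + 4 by ring, Real.exp_add, Real.exp_add, hexpL]
        field_simp
        ring

end Asymptotics

end LatticePath

theorem theorem8p4 :
    ∃ δ η : ℕ → ℝ, Tendsto δ atTop (𝓝 0) ∧ Tendsto η atTop (𝓝 0) ∧
      ∀ (m : ℕ) [NeZero m],
        1 - η m ≤ (LatticePath.updateLaw m m).real
          {ω | ENNReal.ofReal
              ((1 - δ m) * (2 / Real.pi ^ 2 * ((2 * m : ℕ) : ℝ) ^ 3 * Real.log ((2 * m : ℕ) : ℝ)))
            ≤ ((LatticePath.coalescenceTime ω : ℕ∞) : ENNReal)} := by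
  have hs : Tendsto (fun m : ℕ => √(Real.log ((2 * m : ℕ) : ℝ))) atTop atTop := by
    refine Real.tendsto_sqrt_atTop.comp (Real.tendsto_log_atTop.comp
      (tendsto_natCast_atTop_atTop.comp ?_))
    exact tendsto_id.const_mul_atTop' (by norm_num)
  -- This `δ` gives an exponent `log n - √(log n)` up to a constant: `exp (-√(log n))` beats the
  -- factor `log n` from the variance, while `δ` still vanishes. For `m < 2` the bound is made
  -- vacuous.
  refine ⟨fun m => 1 / √(Real.log ((2 * m : ℕ) : ℝ)), fun m => if m < 2 then 1 else
    Real.exp 4 * 32960 *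
      (√(Real.log ((2 * m : ℕ) : ℝ)) ^ 2 * Real.exp (-√(Real.log ((2 * m : ℕ) : ℝ)))), ?_, ?_, ?_⟩
  · simp only [one_div]
    exact hs.inv_tendsto_atTop
  · have h := ((Real.tendsto_pow_mul_exp_neg_atTop_nhds_zero 2).comp hs).const_mul
      (Real.exp 4 * 32960)
    rw [mul_zero] at h
    refine h.congr' ?_
    filter_upwards [eventually_ge_atTop 2] with m hm
    rw [if_neg (not_lt.2 hm)]
    rfl
  · intro m _
    by_cases hm : m < 2
    · simp only [if_pos hm, sub_self]
      exact measureReal_nonneg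
    · simp only [if_neg hm]
      set T := (1 - 1 / √(Real.log ((2 * m : ℕ) : ℝ))) *
        (2 / Real.pi ^ 2 * ((2 * m : ℕ) : ℝ) ^ 3 * Real.log ((2 * m : ℕ) : ℝ)) with hT
      by_cases hT0 : 0 ≤ T
      · have h := LatticePath.coalesced_probability_le_log (not_lt.1 hm) (t := ⌊T⌋₊)
          (Nat.floor_le hT0)
        have hc := probReal_compl_eq_one_sub (μ := LatticePath.updateLaw m m)
          (LatticePath.measurableSet_run_eq (LatticePath.top m m) (LatticePath.bottom m m) ⌊T⌋₊)
        refine (sub_le_sub_left h 1).trans (hc.symm.le.trans (measureReal_mono fun ω hω => ?_))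
        simp only [Set.mem_ofPred_eq]
        by_contra hlt
        refine hω (LatticePath.run_eq_of_coalescenceTime_lt ?_ (not_le.1 hlt))
        rw [ENNReal.ofReal_le_iff_le_toReal (by simp), ENNReal.toReal_natCast]
        push_cast
        exact (Nat.lt_floor_add_one T).le
      · have : ENNReal.ofReal T = 0 := ENNReal.ofReal_of_nonpos (not_le.1 hT0).le
        simp only [this, zero_le, Set.ofPred_true, probReal_univ]
        have h0 : 0 ≤ Real.exp 4 * 32960 * (√(Real.log ((2 * m : ℕ) : ℝ)) ^ 2 *
          Real.exp (-√(Real.log ((2 * m : ℕ) : ℝ)))) := by positivity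
        linarith
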